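/- Let $m\ge 2$ and let $X_1,\dots,X_m$ be non-empty quandles such that the inner automorphism group $\operatorname{Inn}(X_i)$ (the group of permutations of $X_i$ generated by the maps $S_x\colon y\mapsto y*x$, $x\in X_i$) is amenable for at least one $i$, that is, it admits a finitely additive left-invariant probability measure defined on all of its subsets. Let $X=X_1*\cdots*X_m$ be the free product, i.e. the coproduct of $X_1,\dots,X_m$ in the category of quandles. Then the real vector space $H^2_b(X,\mathbb{R})$ is infinite dimensional. Here $H^n_b(X,\mathbb{R})$ denotes the bounded quandle cohomology of $X$, that is, the cohomology of the complex whose $n$-cochains are the bounded functions $f\colon X^n\to\mathbb{R}$ satisfying $f(x_1,\dots,x_n)=0$ whenever $x_i=x_{i+1}$ for some $i$, with coboundary $$\delta f(x_1,\dots,x_{n+1})=\sum_{i=1}^{n+1}(-1)^i\bigl(f(x_1,\dots,x_{i-1},x_{i+1},\dots,x_{n+1})-f(x_1*x_i,\dots,x_{i-1}*x_i,x_{i+1},\dots,x_{n+1})\bigr).$$ -/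

import Mathlib

open scoped Quandles

universe u v w

/-!
Mathlib writes the quandle operation as a left action: `y ◃ x` is the image of `x` under the
symmetry `S_y`. In the right-handed notation, `x * y = S_y(x)` is `y ◃ x`.
-/

/-- A (discrete) group is amenable if it carries a finitely additive, left-invariant probability
measure defined on all of its subsets. -/
def IsAmenableGroup (G : Type u) [Group G] : Prop :=
  ∃ μ : Set G → ℝ,
    (∀ A, 0 ≤ μ A) ∧
    μ Set.univ = 1 ∧
    (∀ A B, Disjoint A B → μ (A ∪ B) = μ A + μ B) ∧
    ∀ (g : G) (A : Set G), μ ((fun x => g * x) '' A) = μ A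

/-- The inner automorphism group of a rack: the group of permutations generated by the
symmetries `S_x : y ↦ x ◃ y`. -/
def Rack.Inn (X : Type u) [Rack X] : Subgroup (Equiv.Perm X) :=
  Subgroup.closure (Set.range (Rack.act' : X → Equiv.Perm X))

/-! ### Free products (coproducts) of quandles -/

namespace Quandle

/-- Formal quandle words in the elements of the quandles `X i`. -/
inductive FreeProdWord {ι : Type v} (X : ι → Type u) : Type (max u v)
  | of (i : ι) (x : X i) : FreeProdWord X
  | act (a b : FreeProdWord X) : FreeProdWord X
  | invAct (a b : FreeProdWord X) : FreeProdWord X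

/-- The smallest congruence on formal words that forces the quandle axioms and the operations of
the individual quandles `X i`. -/
inductive FreeProdRel {ι : Type v} (X : ι → Type u) [∀ i, Quandle (X i)] :
    FreeProdWord X → FreeProdWord X → Prop
  | refl (a) : FreeProdRel X a a
  | symm {a b} : FreeProdRel X a b → FreeProdRel X b a
  | trans {a b c} : FreeProdRel X a b → FreeProdRel X b c → FreeProdRel X a c
  | act_congr {a a' b b'} : FreeProdRel X a a' → FreeProdRel X b b' →
      FreeProdRel X (.act a b) (.act a' b')
  | invAct_congr {a a' b b'} : FreeProdRel X a a' → FreeProdRel X b b' →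
      FreeProdRel X (.invAct a b) (.invAct a' b')
  | self_distrib (a b c) :
      FreeProdRel X (.act a (.act b c)) (.act (.act a b) (.act a c))
  | left_inv (a b) : FreeProdRel X (.invAct a (.act a b)) b
  | right_inv (a b) : FreeProdRel X (.act a (.invAct a b)) b
  | fix (a) : FreeProdRel X (.act a a) a
  | of_act (i) (x y : X i) : FreeProdRel X (.of i (x ◃ y)) (.act (.of i x) (.of i y))

/-- The congruence `FreeProdRel` as a setoid. -/
def freeProdSetoid {ι : Type v} (X : ι → Type u) [∀ i, Quandle (X i)] :
    Setoid (FreeProdWord X) where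
  r := FreeProdRel X
  iseqv := ⟨.refl, .symm, .trans⟩

/-- The free product of a family of quandles. -/
def FreeProd {ι : Type v} (X : ι → Type u) [∀ i, Quandle (X i)] : Type (max u v) :=
  Quotient (freeProdSetoid X)

namespace FreeProd

instance instQuandle {ι : Type v} (X : ι → Type u) [∀ i, Quandle (X i)] :
    Quandle (FreeProd X) where
  act := Quotient.map₂ FreeProdWord.act fun _ _ ha _ _ hb => .act_congr ha hb
  invAct := Quotient.map₂ FreeProdWord.invAct fun _ _ ha _ _ hb => .invAct_congr ha hb
  self_distrib := by
    rintro ⟨a⟩ ⟨b⟩ ⟨c⟩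
    exact Quotient.sound (FreeProdRel.self_distrib a b c)
  left_inv := by
    rintro ⟨a⟩ ⟨b⟩
    exact Quotient.sound (FreeProdRel.left_inv a b)
  right_inv := by
    rintro ⟨a⟩ ⟨b⟩
    exact Quotient.sound (FreeProdRel.right_inv a b)
  fix := by
    rintro ⟨a⟩
    exact Quotient.sound (FreeProdRel.fix a)

/-- The element of the free product represented by a formal word. -/
def mk {ι : Type v} {X : ι → Type u} [∀ i, Quandle (X i)] (a : FreeProdWord X) : FreeProd X :=
  Quotient.mk (freeProdSetoid X) a

/-- The canonical homomorphism from a factor to the free product. -/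
def incl {ι : Type v} (X : ι → Type u) [∀ i, Quandle (X i)] (i : ι) : X i →◃ FreeProd X where
  toFun x := mk (.of i x)
  map_act' := fun {x y} => Quotient.sound (FreeProdRel.of_act i x y)

/-- Evaluation of a formal word in a quandle `Y`. -/
def evalWord {ι : Type v} {X : ι → Type u} [∀ i, Quandle (X i)] {Y : Type w} [Quandle Y]
    (f : ∀ i, X i →◃ Y) : FreeProdWord X → Y
  | .of i x => f i x
  | .act a b => evalWord f a ◃ evalWord f b
  | .invAct a b => evalWord f a ◃⁻¹ evalWord f b

theorem evalWord_rel {ι : Type v} {X : ι → Type u} [∀ i, Quandle (X i)] {Y : Type w} [Quandle Y]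
    (f : ∀ i, X i →◃ Y) {a b : FreeProdWord X} (h : FreeProdRel X a b) :
    evalWord f a = evalWord f b := by
  induction h with
  | refl a => rfl
  | symm _ ih => exact ih.symm
  | trans _ _ ih₁ ih₂ => exact ih₁.trans ih₂
  | act_congr _ _ ih₁ ih₂ => simp only [evalWord, ih₁, ih₂]
  | invAct_congr _ _ ih₁ ih₂ => simp only [evalWord, ih₁, ih₂]
  | self_distrib a b c => exact Shelf.self_distrib
  | left_inv a b => exact Rack.left_inv _ _
  | right_inv a b => exact Rack.right_inv _ _
  | fix a => exact Quandle.fix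
  | of_act i x y => exact (f i).map_act

/-- The homomorphism out of the free product induced by homomorphisms out of the factors. -/
def lift {ι : Type v} {X : ι → Type u} [∀ i, Quandle (X i)] {Y : Type w} [Quandle Y]
    (f : ∀ i, X i →◃ Y) : FreeProd X →◃ Y where
  toFun := Quotient.lift (evalWord f) fun _ _ h => evalWord_rel f h
  map_act' := by
    rintro ⟨a⟩ ⟨b⟩
    rfl

/-- The free product is the coproduct in the category of quandles. -/
theorem existsUnique_lift {ι : Type v} {X : ι → Type u} [∀ i, Quandle (X i)] {Y : Type w}
    [Quandle Y] (f : ∀ i, X i →◃ Y) :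
    ∃! F : FreeProd X →◃ Y, ∀ (i : ι) (x : X i), F (incl X i x) = f i x := by
  refine ⟨lift f, fun _ _ => rfl, fun F hF => ?_⟩
  have key : ∀ a : FreeProdWord X, F (mk a) = evalWord f a := by
    intro a
    induction a with
    | of i x => exact hF i x
    | act a b iha ihb =>
      have h := F.map_act (x := mk a) (y := mk b)
      rw [iha, ihb] at h
      exact h
    | invAct a b iha ihb =>
      have h := F.map_act (x := mk a) (y := mk (.invAct a b))
      have e : mk a ◃ mk (.invAct a b) = mk b := Quotient.sound (FreeProdRel.right_inv a b)
      rw [e, iha, ihb] at h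
      change _ = evalWord f a ◃⁻¹ evalWord f b
      rw [h]
      exact (Rack.left_inv _ _).symm
  apply ShelfHom.ext
  funext z
  induction z using Quotient.inductionOn with
  | h a => exact key a

end FreeProd

/-! ### Bounded quandle cohomology with real coefficients -/

/-- The two faces of a tuple that correspond to its `i`-th entry: `face₀` omits `x i`. -/
def face₀ {X : Type u} {n : ℕ} (i : Fin (n + 1)) (x : Fin (n + 1) → X) : Fin n → X :=
  fun j => x (i.succAbove j)

/-- `face₁` omits `x i` and acts with `x i` on all entries that precede it. -/
def face₁ {X : Type u} [Quandle X] {n : ℕ} (i : Fin (n + 1)) (x : Fin (n + 1) → X) : Fin n → X :=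
  fun j => if j.castSucc < i then x i ◃ x (i.succAbove j) else x (i.succAbove j)

/-- The rack coboundary `C^n(X, ℝ) → C^{n+1}(X, ℝ)`. The exponent is `i + 1` because entries are
numbered from `0` here: the first entry carries the sign `-1`. -/
def coboundary (X : Type u) [Quandle X] (n : ℕ) :
    ((Fin n → X) → ℝ) →ₗ[ℝ] ((Fin (n + 1) → X) → ℝ) where
  toFun f x := ∑ i : Fin (n + 1), (-1 : ℝ) ^ ((i : ℕ) + 1) * (f (face₀ i x) - f (face₁ i x))
  map_add' f g := by
    funext x
    simp only [Pi.add_apply]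
    rw [← Finset.sum_add_distrib]
    exact Finset.sum_congr rfl fun i _ => by ring
  map_smul' c f := by
    funext x
    simp only [Pi.smul_apply, smul_eq_mul, RingHom.id_apply]
    rw [Finset.mul_sum]
    exact Finset.sum_congr rfl fun i _ => by ring

/-- Bounded quandle `n`-cochains: bounded functions `X^n → ℝ` that vanish on every tuple in which
two neighbouring entries coincide (for `n ≤ 1` there are no such tuples). -/
def boundedCochains (X : Type u) [Quandle X] (n : ℕ) : Submodule ℝ ((Fin n → X) → ℝ) where
  carrier := {f | (∃ C : ℝ, ∀ x, |f x| ≤ C) ∧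
    ∀ x : Fin n → X, (∃ i j : Fin n, (i : ℕ) + 1 = j ∧ x i = x j) → f x = 0}
  zero_mem' := ⟨⟨0, fun _ => by simp⟩, fun _ _ => rfl⟩
  add_mem' := by
    rintro f g ⟨⟨C, hC⟩, hf⟩ ⟨⟨D, hD⟩, hg⟩
    exact ⟨⟨C + D, fun x => (abs_add_le _ _).trans (add_le_add (hC x) (hD x))⟩,
      fun x hx => by simp [hf x hx, hg x hx]⟩
  smul_mem' := by
    rintro c f ⟨⟨C, hC⟩, hf⟩
    exact ⟨⟨|c| * C, fun x => by
      simpa [abs_mul] using mul_le_mul_of_nonneg_left (hC x) (abs_nonneg c)⟩,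
      fun x hx => by simp [hf x hx]⟩

/-- Bounded quandle `n`-cocycles. -/
def boundedCocycles (X : Type u) [Quandle X] (n : ℕ) : Submodule ℝ ((Fin n → X) → ℝ) :=
  boundedCochains X n ⊓ LinearMap.ker (coboundary X n)

/-- Bounded quandle `n`-coboundaries: coboundaries of bounded quandle `(n - 1)`-cochains. -/
def boundedCoboundaries (X : Type u) [Quandle X] : (n : ℕ) → Submodule ℝ ((Fin n → X) → ℝ)
  | 0 => ⊥
  | n + 1 => (boundedCochains X n).map (coboundary X n)

/-- The bounded quandle cohomology `H^n_b(X, ℝ)`. -/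
abbrev BoundedCohomology (X : Type u) [Quandle X] (n : ℕ) : Type u :=
  boundedCocycles X n ⧸ (boundedCoboundaries X n).submoduleOf (boundedCocycles X n)

end Quandle

/-! If a function `f` on a quandle changes boundedly under the action, its coboundary is a bounded
2-cocycle; this class vanishes exactly when `f` is at bounded distance from a function invariant
under the action. Unbounded growth along one orbit therefore gives nonzero classes. A height with
unit steps can be composed with the powers `t ^ (1 / (k + 1))`, which are independent modulo bounded
functions (`linearIndependent_mkQ_rootSeq`); this yields infinitely many independent classes
(`not_finiteDimensional_boundedCohomology_two`). The universal property of the free product supplies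
the height, pulled back from `ShiftQuandle`. -/

namespace Quandle

/-! ### Functions of sublinear growth modulo bounded functions -/

/-- Bounded real sequences. -/
def boundedSeq : Submodule ℝ (ℕ → ℝ) where
  carrier := {u | ∃ C : ℝ, ∀ n, |u n| ≤ C}
  zero_mem' := ⟨0, fun _ => by simp⟩
  add_mem' := by
    rintro u v ⟨C, hC⟩ ⟨D, hD⟩
    exact ⟨C + D, fun n => (abs_add_le _ _).trans (add_le_add (hC n) (hD n))⟩
  smul_mem' := by
    rintro c u ⟨C, hC⟩
    exact ⟨|c| * C, fun n => by
      simpa [abs_mul] using mul_le_mul_of_nonneg_left (hC n) (abs_nonneg c)⟩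

/-- The operator `u ↦ (n ↦ u (2 * n))` on real sequences modulo bounded sequences. -/
noncomputable def dilation : Module.End ℝ ((ℕ → ℝ) ⧸ boundedSeq) :=
  boundedSeq.mapQ boundedSeq (LinearMap.funLeft ℝ ℝ fun n => 2 * n) fun _ ⟨C, hC⟩ =>
    ⟨C, fun n => hC (2 * n)⟩

/-- The exponents `1 / (k + 1)`. -/
noncomputable def rootExp (k : ℕ) : ℝ := 1 / ((k : ℝ) + 1)

theorem rootExp_pos (k : ℕ) : 0 < rootExp k := Nat.one_div_pos_of_nat

theorem rootExp_le_one (k : ℕ) : rootExp k ≤ 1 :=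
  (div_le_one (by positivity)).2 (by simp)

theorem rootExp_injective : Function.Injective rootExp := fun j k h => by
  simpa [rootExp] using h

/-- The sequence `n ↦ n ^ (1 / (k + 1))`. -/
noncomputable def rootSeq (k n : ℕ) : ℝ := (n : ℝ) ^ rootExp k

theorem rootSeq_notMem_boundedSeq (k : ℕ) : rootSeq k ∉ boundedSeq := by
  rintro ⟨C, hC⟩
  have ht := (tendsto_rpow_atTop (rootExp_pos k)).comp (tendsto_natCast_atTop_atTop (R := ℝ))
  obtain ⟨n, hn⟩ := (ht.eventually_gt_atTop C).exists
  exact absurd ((le_abs_self _).trans (hC n)) (not_le.2 hn)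

/-- The powers `n ^ (1 / (k + 1))` are linearly independent modulo bounded sequences: they are
eigenvectors of the dilation for different eigenvalues. -/
theorem linearIndependent_mkQ_rootSeq :
    LinearIndependent ℝ fun k => boundedSeq.mkQ (rootSeq k) := by
  refine Module.End.eigenvectors_linearIndependent' dilation (fun k => (2 : ℝ) ^ rootExp k)
    (fun j k h => rootExp_injective ?_) _ fun k => ⟨?_, ?_⟩
  · exact (Real.strictMono_rpow_of_base_gt_one one_lt_two).injective h
  · rw [Module.End.mem_eigenspace_iff, ← map_smul]
    change boundedSeq.mkQ _ = _
    congr 1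
    funext n
    simp [rootSeq, LinearMap.funLeft, Real.mul_rpow]
  · rw [Ne, Submodule.mkQ_apply, Submodule.Quotient.mk_eq_zero]
    exact rootSeq_notMem_boundedSeq k

/-- Powers with exponent at most one are subadditive. This is what keeps the coboundaries of the
composed heights bounded. -/
theorem rootSeq_le_add_one (k : ℕ) {a b : ℕ} (h : a ≤ b + 1) :
    rootSeq k a ≤ rootSeq k b + 1 := by
  have hab : (a : ℝ) ≤ b + 1 := by exact_mod_cast h
  calc (a : ℝ) ^ rootExp k ≤ ((b : ℝ) + 1) ^ rootExp k :=
        Real.rpow_le_rpow a.cast_nonneg hab (rootExp_pos k).le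
    _ ≤ (b : ℝ) ^ rootExp k + 1 ^ rootExp k :=
        Real.rpow_add_le_add_rpow b.cast_nonneg zero_le_one (rootExp_pos k).le (rootExp_le_one k)
    _ = rootSeq k b + 1 := by rw [Real.one_rpow, rootSeq]

/-! ### Cocycles from functions that vary boundedly along the quandle action -/

section Cocycles

variable {X : Type u} [Quandle X]

/-- Nothing precedes the first entry, so its two faces agree and cancel. -/
theorem coboundary_one_apply (f : (Fin 1 → X) → ℝ) (x : Fin 2 → X) :
    coboundary X 1 f x = f (fun _ => x 0) - f (fun _ => x 1 ◃ x 0) := by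
  have h₀ : face₀ 0 x = fun _ => x 1 := by
    funext j; fin_cases j; rfl
  have h₁ : face₁ 0 x = fun _ => x 1 := by
    funext j; fin_cases j; rfl
  have h₂ : face₀ 1 x = fun _ => x 0 := by
    funext j; fin_cases j; rfl
  have h₃ : face₁ 1 x = fun _ => x 1 ◃ x 0 := by
    funext j; fin_cases j; rfl
  simp [coboundary, h₀, h₁, h₂, h₃]

theorem coboundary_two_coboundary_one (f : (Fin 1 → X) → ℝ) :
    coboundary X 2 (coboundary X 1 f) = 0 := by
  funext x
  rw [coboundary, LinearMap.coe_mk, AddHom.coe_mk, Fin.sum_univ_three]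
  simp only [coboundary_one_apply]
  have h : x 2 ◃ (x 1 ◃ x 0) = (x 2 ◃ x 1) ◃ (x 2 ◃ x 0) := Shelf.self_distrib
  simp [face₀, face₁, Fin.succAbove, Fin.lt_def, h]
  ring

/-- The coboundary of a function that varies boundedly along the action is a bounded cocycle. -/
theorem coboundary_one_mem_boundedCocycles {f : (Fin 1 → X) → ℝ} {C : ℝ}
    (hf : ∀ x y : X, |f (fun _ => x) - f (fun _ => y ◃ x)| ≤ C) :
    coboundary X 1 f ∈ boundedCocycles X 2 := by
  refine ⟨⟨⟨C, fun x => ?_⟩, ?_⟩, coboundary_two_coboundary_one f⟩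
  · rw [coboundary_one_apply]
    exact hf _ _
  · rintro x ⟨i, j, hij, hx⟩
    obtain rfl : i = 0 := by omega
    obtain rfl : j = 1 := by omega
    rw [coboundary_one_apply, ← hx, Quandle.fix, sub_self]

/-- A quandle has infinite dimensional second bounded cohomology if it carries an integer valued
function that changes by at most one under the action and takes every natural value along
a sequence generated by the symmetry of one element. -/
theorem not_finiteDimensional_boundedCohomology_two (h : X → ℤ)
    (hh : ∀ x y : X, |h x - h (y ◃ x)| ≤ 1) (b : X) (x : ℕ → X)
    (hx : ∀ n, x (n + 1) = b ◃ x n) (hhx : ∀ n : ℕ, h (x n) = n) :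
    ¬ FiniteDimensional ℝ (BoundedCohomology X 2) := by
  let F (k : ℕ) (z : Fin 1 → X) : ℝ := rootSeq k (h (z 0)).natAbs
  have hF (k : ℕ) : coboundary X 1 (F k) ∈ boundedCocycles X 2 := by
    refine coboundary_one_mem_boundedCocycles (C := 1) fun z y => ?_
    have := abs_le.1 (hh z y)
    change |rootSeq k (h z).natAbs - rootSeq k (h (y ◃ z)).natAbs| ≤ 1
    rw [abs_sub_le_iff, sub_le_iff_le_add', sub_le_iff_le_add']
    exact ⟨rootSeq_le_add_one k (by omega), rootSeq_le_add_one k (by omega)⟩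
  let Z (k : ℕ) : boundedCocycles X 2 := ⟨coboundary X 1 (F k), hF k⟩
  have hZ : LinearIndependent ℝ fun k =>
      ((boundedCoboundaries X 2).submoduleOf (boundedCocycles X 2)).mkQ (Z k) := by
    rw [linearIndependent_iff']
    intro s c hc
    -- Restriction to the orbit `x` turns the relation between classes into one between the `rootSeq
    -- k` modulo bounded sequences.
    refine linearIndependent_iff'.1 linearIndependent_mkQ_rootSeq s c ?_
    simp only [← map_smul, ← map_sum] at hc ⊢
    rw [Submodule.mkQ_apply, Submodule.Quotient.mk_eq_zero] at hc ⊢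
    obtain ⟨g, ⟨⟨C, hC⟩, -⟩, hg⟩ := hc
    -- With `g` a bounded primitive, the difference is a 1-cocycle, that is, invariant under the
    -- action, hence constant along `x`.
    have hδ : coboundary X 1 (∑ k ∈ s, c k • F k - g) = 0 := by
      rw [map_sub, hg, map_sum]
      simp [Z]
    have hconst (n : ℕ) : (∑ k ∈ s, c k • F k - g) (fun _ => x n) =
        (∑ k ∈ s, c k • F k - g) (fun _ => x 0) := by
      induction n with
      | zero => rfl
      | succ n ih =>
        have := congrFun hδ ![x n, b]
        rw [coboundary_one_apply] at this
        rw [← ih, hx]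
        exact (sub_eq_zero.1 this).symm
    refine ⟨C + |(∑ k ∈ s, c k • F k - g) (fun _ => x 0)|, fun n => ?_⟩
    have hn : (∑ k ∈ s, c k • rootSeq k) n =
        g (fun _ => x n) + (∑ k ∈ s, c k • F k - g) (fun _ => x 0) := by
      rw [← hconst n]
      simp [F, hhx]
    rw [hn]
    exact (abs_add_le _ _).trans (by gcongr; exact hC _)
  intro hfin
  exact not_finite_iff_infinite.2 (inferInstanceAs (Infinite ℕ)) hZ.finite

end Cocycles

/-! ### A quandle with an unbounded orbit -/

/-- The integers with an additional element `none`, which acts on the integers by the unit shift;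
every integer acts trivially. -/
def ShiftQuandle : Type := Option ℤ

namespace ShiftQuandle

/-- The shift fixes `none`, which gives idempotence, and it permutes the integers, which all act
alike, so it is an automorphism. -/
instance : Quandle ShiftQuandle where
  act (a b : Option ℤ) := a.elim (b.map (· + 1)) fun _ => b
  invAct (a b : Option ℤ) := a.elim (b.map (· - 1)) fun _ => b
  self_distrib := by rintro (_ | a) (_ | b) (_ | c) <;> rfl
  left_inv := by
    rintro (_ | a) (_ | b)
    exacts [rfl, congrArg some (add_sub_cancel_right b 1), rfl, rfl]
  right_inv := by
    rintro (_ | a) (_ | b)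
    exacts [rfl, congrArg some (sub_add_cancel b 1), rfl, rfl]
  fix := by rintro (_ | a) <;> rfl

/-- The constant homomorphism to the shift quandle. -/
def constHom (X : Type u) [Quandle X] (a : ShiftQuandle) : X →◃ ShiftQuandle where
  toFun _ := a
  map_act' := Quandle.fix.symm

/-- The integer underlying an element of the shift quandle, and `0` for the shifting element. -/
def height (a : ShiftQuandle) : ℤ := Option.getD a 0

/-- Every symmetry fixes `none`, so its default height `0` is never compared with that of an
integer. -/
theorem abs_height_sub_le (a b : ShiftQuandle) : |height a - height (b ◃ a)| ≤ 1 := by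
  rcases a with _ | a
  · rcases b with _ | b <;> exact zero_le_one
  · rcases b with _ | b
    · change |a - (a + 1)| ≤ 1
      simp
    · change |a - a| ≤ 1
      simp

end ShiftQuandle

end Quandle

open Quandle in
/-- Map the first factor to the integer `0` of the shift quandle and the others to the shifting
element. The induced integer valued function on the free product changes by at most one under the
action and is unbounded on an orbit. This holds for all non-empty factors, so that the amenability
hypothesis is not used. -/
theorem mainTheorem6 {m : ℕ} (hm : 2 ≤ m) (X : Fin m → Type u) [∀ i, Quandle (X i)]
    [∀ i, Nonempty (X i)] (hX : ∃ i, IsAmenableGroup (Rack.Inn (X i))) :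
    ¬ FiniteDimensional ℝ (Quandle.BoundedCohomology (Quandle.FreeProd X) 2) := by
  let i₀ : Fin m := ⟨0, by omega⟩
  let i₁ : Fin m := ⟨1, by omega⟩
  obtain ⟨a⟩ := ‹∀ i, Nonempty (X i)› i₀
  obtain ⟨b⟩ := ‹∀ i, Nonempty (X i)› i₁
  -- Constant maps are homomorphisms by idempotence, so the factors may be sent to arbitrary
  -- elements. Here `β` goes to `none` and thus raises the height by one at each step.
  let L : FreeProd X →◃ ShiftQuandle := FreeProd.lift fun i =>
    ShiftQuandle.constHom (X i) (if i = i₀ then some (0 : ℤ) else (none : Option ℤ))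
  let β : FreeProd X := FreeProd.incl X i₁ b
  let x (n : ℕ) : FreeProd X := (β ◃ ·)^[n] (FreeProd.incl X i₀ a)
  have hx (n : ℕ) : x (n + 1) = β ◃ x n := Function.iterate_succ_apply' _ _ _
  have hLx (n : ℕ) : L (x n) = some (n : ℤ) := by
    induction n with
    | zero => rfl
    | succ n ih =>
      rw [hx, ShelfHom.map_act, ih]
      rfl
  refine not_finiteDimensional_boundedCohomology_two (fun z => (L z).height)
    (fun z y => ?_) β x hx fun n => ?_
  · rw [ShelfHom.map_act]
    exact ShiftQuandle.abs_height_sub_le _ _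
  · rw [hLx]
    rfl
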